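/- Let $l\ge 2$ be an integer. For $q>0$ let $P_n^q$ be the Mallows distribution on the permutations $\sigma=\sigma_1\cdots\sigma_n$ of $\{1,\dots,n\}$, i.e. $P_n^q(\sigma)=q^{\mathrm{inv}(\sigma)}/Z_n(q)$, where $\mathrm{inv}(\sigma)$ is the number of pairs $i<j$ with $\sigma_i>\sigma_j$ and $Z_n(q)$ is the normalization constant. For $1\le k\le n-l+1$ let $A^{(n)}_{l;k}$ be the event that the numbers $k,k+1,\dots,k+l-1$ appear in $l$ consecutive positions, i.e. that $\{k,\dots,k+l-1\}=\{\sigma_m,\dots,\sigma_{m+l-1}\}$ for some $m\in\{1,\dots,n-l+1\}$. Write $a_n\lesssim b_n$ if $\limsup_{n\to\infty}a_n/b_n\le 1$. (i) Let $c>0$, $d\in(0,1)$, $q_n=1-\frac cn$ and $k_n\sim dn$ as $n\to\infty$. Then $$P_n^{q_n}\big(A^{(n)}_{l;k_n}\big)\lesssim \frac1{(1-e^{-cd})^l}\left(\int_{e^{-cd}}^1 y^{l-1}\,e^{\gamma(c,d)\,e^{cd}(l-1)y}\,dy\right)\frac{c^{l-1}\,l!}{n^{l-1}},\qquad \gamma(c,d)=\log\frac{1-e^{-cd}}{1-e^{-c}}.$$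 (ii) Let $q_n<1$ with $1-q_n=o(\frac1n)$ as $n\to\infty$. Then, for any choice of $\{k_n\}$ with $1\le k_n\le n-l+1$, $$P_n^{q_n}\big(A^{(n)}_{l;k_n}\big)\lesssim\frac{l!}{n^{l-1}}.$$ -/

import Mathlib

open Filter Asymptotics

noncomputable section

/-- The number of inversions of the permutation `σ = σ₁ ⋯ σₙ`: pairs of positions `i < j` whose
entries satisfy `σ_i > σ_j`. Positions and numbers are indexed from `0` in `Fin n`. -/
def inversionCount {n : ℕ} (σ : Equiv.Perm (Fin n)) : ℕ :=
  (Finset.univ.filter fun p : Fin n × Fin n => p.1 < p.2 ∧ σ p.2 < σ p.1).card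

/-- The normalization constant of the Mallows distribution. -/
def mallowsPartition (n : ℕ) (q : ℝ) : ℝ :=
  ∑ σ : Equiv.Perm (Fin n), q ^ inversionCount σ

/-- The point mass that the Mallows distribution with parameter `q` gives to `σ`. -/
def mallowsMass (n : ℕ) (q : ℝ) (σ : Equiv.Perm (Fin n)) : ℝ :=
  q ^ inversionCount σ / mallowsPartition n q

open scoped Classical in
/-- The probability of an event under the Mallows distribution with parameter `q`. -/
def mallowsProb (n : ℕ) (q : ℝ) (A : Set (Equiv.Perm (Fin n))) : ℝ :=
  ∑ σ : Equiv.Perm (Fin n), if σ ∈ A then mallowsMass n q σ else 0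

/-- The event that the numbers `k, …, k + l - 1` fill `l` consecutive positions `m, …, m + l - 1`
of the permutation. Here `k` and `m` count from `1`: the element `i : Fin n` stands for the
position `i + 1`, and the entry there is the number `σ i + 1`. -/
def clusterEvent (n l k : ℕ) : Set (Equiv.Perm (Fin n)) :=
  {σ | ∃ m : ℕ, 1 ≤ m ∧ m + l ≤ n + 1 ∧
    (fun i : Fin n => (σ i : ℕ) + 1) '' {i : Fin n | m ≤ (i : ℕ) + 1 ∧ (i : ℕ) + 1 < m + l} =
      Set.Ico k (k + l)}

/-- `a n ≲ b n`, that is, `limsup (a n / b n) ≤ 1`. The upper limit is taken in the extended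
reals, so that it is meaningful for unbounded sequences too. -/
def AsympLE (a b : ℕ → ℝ) : Prop :=
  limsup (fun n => ((a n / b n : ℝ) : EReal)) atTop ≤ 1

/-- `γ(c, d) = log ((1 - e^{-cd}) / (1 - e^{-c}))`. -/
def clusterGamma (c d : ℝ) : ℝ :=
  Real.log ((1 - Real.exp (-(c * d))) / (1 - Real.exp (-c)))

end

/-! A Mallows permutation arises by inserting entries in increasing order: an entry placed with `e`
entries to its right adds `e` inversions. With `l = L + 1`, follow the block of `l` chosen entries
through the number `a` of positions to its right. `blockWeight_top_le` bounds its weight once its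
last entry is in. Each later entry must not split the block: it goes to the right (`a` grows by one)
or to the left (`a` stays). This gives a linear recursion in `a`.

In the variable `x = q ^ a`, the dual operator has the eigenfunctions `x ^ r (1 - q x) ⋯ (1 - q ^ (L
- r) x)` (`blockEigenfun_eq`). They are the same at every size, so a normalized moment only picks up
the scalar `decayFactor`. They dominate `x ^ r (1 - x) ^ (L - r)`, so their binomial combination
dominates `1`, and `mallowsProb_clusterEvent_le_sum` follows.

In case (i) the `r`-th decay factor is at most the `r`-th power of the first, and the binomial
theorem resums the bound. Its limit contains the integral of `y ^ L (1 - (1 - E) y) ^ L` over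
`[e^{-cd}, 1]`, with `E` the limit of `decayBase`; `one_sub_mul_le_exp` then gives the exponential.
In case (ii) the terms with `r < L` carry `(n (1 - q)) ^ (L - r) → 0` (`lower_term_le`), while the
term `r = L` telescopes to a bound asymptotic to `l! / n ^ L` (`top_term_le`), both uniformly in
`k`. -/

open scoped Topology

/-! ### Insertion of the largest entry and the partition function -/

open Finset in
theorem inversionCount_eq_sum {n : ℕ} (σ : Equiv.Perm (Fin n)) :
    inversionCount σ = ∑ i, ∑ j, if i < j ∧ σ j < σ i then 1 else 0 := by
  rw [inversionCount, card_filter, ← univ_product_univ, sum_product]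

/-- Insert a new largest entry into the permutation `σ` at position `p`. -/
def insertLargest {N : ℕ} (p : Fin (N + 1)) (σ : Equiv.Perm (Fin N)) :
    Equiv.Perm (Fin (N + 1)) :=
  (finSuccEquiv' p).trans ((Equiv.optionCongr σ).trans (finSuccEquiv' (Fin.last N)).symm)

@[simp] theorem insertLargest_self {N : ℕ} (p : Fin (N + 1)) (σ : Equiv.Perm (Fin N)) :
    insertLargest p σ p = Fin.last N := by
  simp [insertLargest]

@[simp] theorem insertLargest_succAbove {N : ℕ} (p : Fin (N + 1)) (σ : Equiv.Perm (Fin N))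
    (i : Fin N) : insertLargest p σ (p.succAbove i) = (σ i).castSucc := by
  simp [insertLargest]

/-- The position is reversed so that the index counts the entries to the right of the new one, which
is its number of inversions. -/
theorem insertLargest_bijective (N : ℕ) :
    Function.Bijective
      (fun x : Fin (N + 1) × Equiv.Perm (Fin N) => insertLargest x.1.rev x.2) := by
  rw [Fintype.bijective_iff_injective_and_card]
  constructor
  · rintro ⟨p, σ⟩ ⟨p', σ'⟩ h
    dsimp only at h
    have hp : p = p' := by
      have h1 := insertLargest_self p.rev σ
      rw [h, ← insertLargest_self p'.rev σ'] at h1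
      exact Fin.rev_injective ((insertLargest p'.rev σ').injective h1)
    subst hp
    congr 1
    ext i
    have := congrArg (fun τ => τ (p.rev.succAbove i)) h
    simpa using congrArg Fin.val this
  · simp [Fintype.card_perm, Nat.factorial_succ]

theorem inversionCount_insertLargest {N : ℕ} (e : Fin (N + 1)) (σ : Equiv.Perm (Fin N)) :
    inversionCount (insertLargest e.rev σ) = e + inversionCount σ := by
  rw [inversionCount_eq_sum, inversionCount_eq_sum, Fin.sum_univ_succAbove _ e.rev]
  congr 1
  · rw [Fin.sum_univ_succAbove _ e.rev]
    simp only [lt_self_iff_false, false_and, if_false, insertLargest_succAbove,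
      insertLargest_self, Fin.castSucc_lt_last, and_true, zero_add]
    rw [← Finset.card_filter]
    have h : (Finset.univ.filter fun j : Fin N => e.rev < e.rev.succAbove j).card
        = (Finset.univ.filter fun j : Fin N => ¬ (j : ℕ) < N - e).card := by
      congr 1
      ext j
      simp only [Finset.mem_filter, Finset.mem_univ, true_and, Fin.lt_succAbove_iff_le_castSucc,
        Fin.le_def, Fin.val_rev, Fin.val_castSucc]
      omega
    have h2 := Finset.card_filter_add_card_filter_not (s := (Finset.univ : Finset (Fin N)))
      (fun j => (j : ℕ) < N - e)
    rw [Fin.card_filter_val_lt, Finset.card_univ, Fintype.card_fin] at h2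
    rw [h]
    have := e.2
    omega
  · refine Finset.sum_congr rfl fun i _ => ?_
    rw [Fin.sum_univ_succAbove _ e.rev]
    simp [Fin.succAbove_lt_succAbove_iff, Fin.not_lt.mpr (Fin.le_last _)]

theorem sum_perm_succ {N : ℕ} (f : Equiv.Perm (Fin (N + 1)) → ℝ) :
    ∑ σ, f σ = ∑ e : Fin (N + 1), ∑ σ : Equiv.Perm (Fin N), f (insertLargest e.rev σ) := by
  rw [← Fintype.sum_prod_type']
  exact (Fintype.sum_bijective _ (insertLargest_bijective N) _ _ fun _ => rfl).symm

/-- The `q`-analogue `1 + q + ⋯ + q ^ (j - 1)` of `j`. -/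
noncomputable def qNat (q : ℝ) (j : ℕ) : ℝ := ∑ i ∈ Finset.range j, q ^ i

theorem mallowsPartition_succ (N : ℕ) (q : ℝ) :
    mallowsPartition (N + 1) q = qNat q (N + 1) * mallowsPartition N q := by
  simp only [mallowsPartition, qNat]
  rw [sum_perm_succ, Finset.sum_range, Finset.sum_mul]
  refine Finset.sum_congr rfl fun e _ => ?_
  rw [Finset.mul_sum]
  refine Finset.sum_congr rfl fun σ _ => ?_
  rw [inversionCount_insertLargest, pow_add]

theorem mallowsPartition_zero (q : ℝ) : mallowsPartition 0 q = 1 := by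
  simp [mallowsPartition, inversionCount]

theorem mallowsPartition_eq_prod (N : ℕ) (q : ℝ) :
    mallowsPartition N q = ∏ i ∈ Finset.range N, qNat q (i + 1) := by
  induction N with
  | zero => simp [mallowsPartition_zero]
  | succ N ih => rw [mallowsPartition_succ, ih, Finset.prod_range_succ, mul_comm]

/-! ### Blocks of consecutive entries under insertion -/

/-- The entries `k, …, k + s - 1` (counted from `0`) fill `s` consecutive positions, with exactly
`a` positions to the right of them. -/
def IsBlock (N k s a : ℕ) (σ : Equiv.Perm (Fin N)) : Prop :=
  ∀ i : Fin N, (N ≤ i + a + s ∧ i + a < N) ↔ (k ≤ (σ i : ℕ) ∧ (σ i : ℕ) < k + s)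

open scoped Classical in
/-- The total Mallows weight of the permutations in `IsBlock`. -/
noncomputable def blockWeight (q : ℝ) (N k s a : ℕ) : ℝ :=
  ∑ σ : Equiv.Perm (Fin N), if IsBlock N k s a σ then q ^ inversionCount σ else 0

theorem blockWeight_nonneg {q : ℝ} (hq : 0 ≤ q) (N k s a : ℕ) : 0 ≤ blockWeight q N k s a := by
  refine Finset.sum_nonneg fun σ _ => ?_
  split_ifs <;> positivity

theorem val_succAbove {N : ℕ} (p : Fin (N + 1)) (i : Fin N) :
    ((p.succAbove i : Fin (N + 1)) : ℕ) = if (i : ℕ) < p then (i : ℕ) else i + 1 := by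
  simp only [Fin.succAbove, Fin.lt_def, Fin.val_castSucc]
  split_ifs <;> simp

theorem IsBlock.of_insertLargest_zero {N k s : ℕ} (hk : k + s ≤ N) {e : Fin (N + 1)}
    {σ : Equiv.Perm (Fin N)} (h : IsBlock (N + 1) k s 0 (insertLargest e.rev σ)) :
    s ≤ e ∧ IsBlock N k s 0 σ := by
  have he := e.2
  have h0 := h e.rev
  simp only [insertLargest_self, Fin.val_rev, Fin.val_last] at h0
  have hse : s ≤ (e : ℕ) := by omega
  refine ⟨hse, fun i => ?_⟩
  have hi := h (e.rev.succAbove i)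
  simp only [insertLargest_succAbove, val_succAbove, Fin.val_rev, Fin.val_castSucc] at hi
  have := i.2
  rw [← hi]
  split_ifs <;> omega

/-- The new entry exceeds every block entry, so it cannot lie inside the block; removing it from the
right lowers `a`, removing it from the left does not. -/
theorem IsBlock.of_insertLargest_succ {N k s a : ℕ} (hk : k + s ≤ N) {e : Fin (N + 1)}
    {σ : Equiv.Perm (Fin N)} (h : IsBlock (N + 1) k s (a + 1) (insertLargest e.rev σ)) :
    ((e : ℕ) < a + 1 ∧ IsBlock N k s a σ) ∨ (a + 1 + s ≤ e ∧ IsBlock N k s (a + 1) σ) := by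
  have he := e.2
  have h0 := h e.rev
  simp only [insertLargest_self, Fin.val_rev, Fin.val_last] at h0
  rcases lt_or_ge (e : ℕ) (a + 1) with hea | hea
  · refine Or.inl ⟨hea, fun i => ?_⟩
    have hi := h (e.rev.succAbove i)
    simp only [insertLargest_succAbove, val_succAbove, Fin.val_rev, Fin.val_castSucc] at hi
    have := i.2
    rw [← hi]
    split_ifs <;> omega
  · have hse : a + 1 + s ≤ (e : ℕ) := by omega
    refine Or.inr ⟨hse, fun i => ?_⟩
    have hi := h (e.rev.succAbove i)
    simp only [insertLargest_succAbove, val_succAbove, Fin.val_rev, Fin.val_castSucc] at hi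
    have := i.2
    rw [← hi]
    split_ifs <;> omega

/-- Here the new entry belongs to the block, and deleting it leaves a shorter block with the same
right end. Its `s + 1` admissible places produce the factor `q ^ a * qNat q (s + 1)`. -/
theorem IsBlock.of_insertLargest_top {k s a : ℕ} {e : Fin (k + s + 1)}
    {σ : Equiv.Perm (Fin (k + s))} (h : IsBlock (k + s + 1) k (s + 1) a (insertLargest e.rev σ)) :
    (a ≤ e ∧ (e : ℕ) < a + (s + 1)) ∧ IsBlock (k + s) k s a σ := by
  have he := e.2
  have h0 := h e.rev
  simp only [insertLargest_self, Fin.val_rev, Fin.val_last] at h0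
  have hse : a ≤ (e : ℕ) ∧ (e : ℕ) < a + (s + 1) := by omega
  refine ⟨hse, fun i => ?_⟩
  have hi := h (e.rev.succAbove i)
  simp only [insertLargest_succAbove, val_succAbove, Fin.val_rev, Fin.val_castSucc] at hi
  have := i.2
  have := (σ i).2
  have : (k ≤ (σ i : ℕ) ∧ (σ i : ℕ) < k + s) ↔ (k ≤ (σ i : ℕ) ∧ (σ i : ℕ) < k + (s + 1)) := by
    omega
  rw [this, ← hi]
  split_ifs <;> omega

theorem blockWeight_succ_eq (q : ℝ) (N k s a : ℕ) [DecidablePred (IsBlock (N + 1) k s a)] :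
    blockWeight q (N + 1) k s a = ∑ e : Fin (N + 1), ∑ σ : Equiv.Perm (Fin N),
      if IsBlock (N + 1) k s a (insertLargest e.rev σ) then
        q ^ (e : ℕ) * q ^ inversionCount σ else 0 := by
  rw [blockWeight, sum_perm_succ]
  refine Finset.sum_congr rfl fun e _ => Finset.sum_congr rfl fun σ _ => ?_
  rw [inversionCount_insertLargest, pow_add]
  congr

theorem sum_fin_ite_mem_mul (q : ℝ) {N k s a : ℕ} [DecidablePred (IsBlock N k s a)]
    {S : Finset ℕ} (hS : S ⊆ Finset.range (N + 1)) :
    (∑ e : Fin (N + 1), ∑ σ : Equiv.Perm (Fin N),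
      if (e : ℕ) ∈ S ∧ IsBlock N k s a σ then q ^ (e : ℕ) * q ^ inversionCount σ else 0) =
      (∑ e ∈ S, q ^ e) * blockWeight q N k s a := by
  have h : ∑ e ∈ S, q ^ e = ∑ e : Fin (N + 1), if (e : ℕ) ∈ S then q ^ (e : ℕ) else 0 := by
    rw [← Finset.sum_range (fun e => if e ∈ S then q ^ e else 0), Finset.sum_ite_mem,
      Finset.inter_eq_right.mpr hS]
  rw [h, Finset.sum_mul]
  refine Finset.sum_congr rfl fun e _ => ?_
  rw [blockWeight, Finset.mul_sum]
  refine Finset.sum_congr rfl fun σ _ => ?_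
  by_cases h1 : (e : ℕ) ∈ S <;> by_cases h2 : IsBlock N k s a σ <;> simp [h1, h2]

/-- Common form of all recursions: a union bound over the two ways a block can survive an insertion.
Only upper bounds are needed, so overlaps and converses are irrelevant. -/
theorem blockWeight_succ_le {q : ℝ} (hq : 0 ≤ q) {N k s s' a b c : ℕ} {S T : Finset ℕ}
    (hS : S ⊆ Finset.range (N + 1)) (hT : T ⊆ Finset.range (N + 1))
    (h : ∀ (e : Fin (N + 1)) (σ : Equiv.Perm (Fin N)),
      IsBlock (N + 1) k s' a (insertLargest e.rev σ) →
        ((e : ℕ) ∈ S ∧ IsBlock N k s b σ) ∨ ((e : ℕ) ∈ T ∧ IsBlock N k s c σ)) :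
    blockWeight q (N + 1) k s' a ≤
      (∑ e ∈ S, q ^ e) * blockWeight q N k s b + (∑ e ∈ T, q ^ e) * blockWeight q N k s c := by
  classical
  rw [blockWeight_succ_eq, ← sum_fin_ite_mem_mul q hS, ← sum_fin_ite_mem_mul q hT,
    ← Finset.sum_add_distrib]
  refine Finset.sum_le_sum fun e _ => ?_
  rw [← Finset.sum_add_distrib]
  refine Finset.sum_le_sum fun σ _ => ?_
  have hpos : 0 ≤ q ^ (e : ℕ) * q ^ inversionCount σ := by positivity
  have hh := h e σ
  split_ifs with h1 h2 h3 h3 <;> first | linarith | (exfalso; tauto)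

theorem blockWeight_succ_zero_le {q : ℝ} (hq : 0 ≤ q) {N k s : ℕ} (hk : k + s ≤ N) :
    blockWeight q (N + 1) k s 0 ≤
      (∑ e ∈ Finset.Ico s (N + 1), q ^ e) * blockWeight q N k s 0 := by
  have := blockWeight_succ_le hq (N := N) (k := k) (s := s) (s' := s) (a := 0) (b := 0) (c := 0)
    (S := ∅) (T := Finset.Ico s (N + 1)) (by simp)
    (by intro x; simp) (fun e σ h => Or.inr ⟨by
      have := (h.of_insertLargest_zero hk).1
      have := e.2
      simp only [Finset.mem_Ico]; omega, (h.of_insertLargest_zero hk).2⟩)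
  simpa using this

theorem blockWeight_succ_succ_le {q : ℝ} (hq : 0 ≤ q) {N k s : ℕ} (hk : k + s ≤ N) (a : ℕ) :
    blockWeight q (N + 1) k s (a + 1) ≤
      (∑ e ∈ Finset.range (min (a + 1) (N + 1)), q ^ e) * blockWeight q N k s a +
      (∑ e ∈ Finset.Ico (a + 1 + s) (N + 1), q ^ e) * blockWeight q N k s (a + 1) := by
  refine blockWeight_succ_le hq (by intro x; simp) (by intro x; simp) fun e σ h => ?_
  have := e.2
  rcases h.of_insertLargest_succ hk with ⟨h1, h2⟩ | ⟨h1, h2⟩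
  · exact Or.inl ⟨by simp only [Finset.mem_range]; omega, h2⟩
  · exact Or.inr ⟨by simp only [Finset.mem_Ico]; omega, h2⟩

theorem blockWeight_top_succ_le {q : ℝ} (hq : 0 ≤ q) {k a : ℕ} (s : ℕ) (ha : a ≤ k) :
    blockWeight q (k + s + 1) k (s + 1) a ≤
      (q ^ a * qNat q (s + 1)) * blockWeight q (k + s) k s a := by
  have := blockWeight_succ_le hq (N := k + s) (k := k) (s := s) (s' := s + 1) (a := a) (b := a)
    (c := a) (S := Finset.Ico a (a + (s + 1))) (T := ∅)
    (by intro x; simp only [Finset.mem_Ico, Finset.mem_range]; omega) (by simp)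
    (fun e σ h => Or.inl ⟨by simpa using h.of_insertLargest_top.1, h.of_insertLargest_top.2⟩)
  rw [Finset.sum_Ico_eq_sum_range] at this
  simpa [pow_add, ← Finset.mul_sum, qNat] using this

theorem blockWeight_top_le {q : ℝ} (hq : 0 ≤ q) {k a : ℕ} (s : ℕ) (ha : a ≤ k) :
    blockWeight q (k + s) k s a ≤
      q ^ (s * a) * (∏ i ∈ Finset.range s, qNat q (i + 1)) * mallowsPartition k q := by
  induction s with
  | zero =>
    simp only [zero_mul, pow_zero, Finset.range_zero, Finset.prod_empty, one_mul]
    refine Finset.sum_le_sum fun σ _ => ?_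
    split_ifs
    · exact le_rfl
    · positivity
  | succ s ih =>
    have hn : 0 ≤ q ^ a * qNat q (s + 1) :=
      mul_nonneg (by positivity) (Finset.sum_nonneg fun _ _ => by positivity)
    refine (blockWeight_top_succ_le hq s ha).trans ((mul_le_mul_of_nonneg_left ih hn).trans_eq ?_)
    rw [Finset.prod_range_succ, Nat.add_mul, pow_add, one_mul]
    ring

theorem IsBlock.of_mem_clusterEvent {n l k : ℕ} (hk : k + l ≤ n)
    {σ : Equiv.Perm (Fin n)} (h : σ ∈ clusterEvent n l (k + 1)) :
    ∃ a < n + 1 - l, IsBlock n k l a σ := by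
  obtain ⟨m, hm, hml, h⟩ := h
  -- `m` counts from `1`, so the block ends at position `m + l - 1` and this many positions follow
  -- it.
  refine ⟨n + 1 - l - m, by omega, fun i => ?_⟩
  have hmem : (m ≤ (i : ℕ) + 1 ∧ (i : ℕ) + 1 < m + l) ↔
      (σ i : ℕ) + 1 ∈ Set.Ico (k + 1) (k + 1 + l) := by
    rw [← h, Set.mem_image]
    constructor
    · exact fun hi => ⟨i, hi, rfl⟩
    · rintro ⟨j, hj, hji⟩
      have : j = i := σ.injective (Fin.ext (by omega))
      exact this ▸ hj
  have := i.2
  rw [Set.mem_Ico] at hmem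
  omega

theorem mallowsPartition_pos {q : ℝ} (hq : 0 < q) (n : ℕ) : 0 < mallowsPartition n q :=
  Finset.sum_pos (fun _ _ => by positivity) Finset.univ_nonempty

theorem mallowsProb_clusterEvent_le {q : ℝ} (hq : 0 < q) {n l k : ℕ} (hk : k + l ≤ n) :
    mallowsProb n q (clusterEvent n l (k + 1)) ≤
      (∑ a ∈ Finset.range (n + 1 - l), blockWeight q n k l a) / mallowsPartition n q := by
  classical
  simp only [blockWeight]
  rw [Finset.sum_comm, Finset.sum_div]
  refine Finset.sum_le_sum fun σ _ => ?_
  have hpos : 0 ≤ q ^ inversionCount σ := by positivity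
  have hZ := mallowsPartition_pos hq n
  split_ifs with h
  · obtain ⟨a, ha, hb⟩ := IsBlock.of_mem_clusterEvent hk h
    rw [mallowsMass]
    refine div_le_div_of_nonneg_right ?_ hZ.le
    refine le_trans ?_ (Finset.single_le_sum (fun a _ => ?_) (Finset.mem_range.mpr ha))
    · rw [if_pos hb]
    · split_ifs <;> positivity
  · refine div_nonneg (Finset.sum_nonneg fun a _ => ?_) hZ.le
    split_ifs <;> positivity

/-! ### Eigenfunctions and the decay of their moments -/

theorem qNat_mul (q : ℝ) (j : ℕ) : (1 - q) * qNat q j = 1 - q ^ j := by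
  rw [qNat, mul_comm, geom_sum_mul_neg]

theorem qNat_pos {q : ℝ} (hq : 0 < q) {j : ℕ} (hj : 0 < j) : 0 < qNat q j :=
  Finset.sum_pos (fun _ _ => by positivity) (Finset.nonempty_range_iff.mpr hj.ne')

theorem qNat_eq_div {q : ℝ} (hq : q < 1) (j : ℕ) : qNat q j = (1 - q ^ j) / (1 - q) := by
  rw [eq_div_iff (by linarith), mul_comm, qNat_mul]

theorem mul_sum_Ico_pow (q : ℝ) {m n : ℕ} (h : m ≤ n) :
    (1 - q) * ∑ e ∈ Finset.Ico m n, q ^ e = q ^ m - q ^ n := by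
  rw [mul_comm, geom_sum_Ico_mul_neg _ h]

/-- `x ^ r (1 - q x) ⋯ (1 - q ^ (L - r) x)`, an eigenfunction of the operator that describes how
the position of a block of `L + 1` entries evolves when larger entries are inserted. -/
noncomputable def blockEigenfun (q : ℝ) (L r : ℕ) (x : ℝ) : ℝ :=
  x ^ r * ∏ i ∈ Finset.range (L - r), (1 - q ^ (i + 1) * x)

/-- The factor `1 - q * x` completes the shifted product to the original one times `1 - q ^ (L - r +
1) * x`; the term `q ^ (L + 1) * x` cancels the excess. The parameter `t`, later `q ^ (N + 1)`, only
shifts the eigenvalue. -/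
theorem blockEigenfun_eq (q : ℝ) {L r : ℕ} (hr : r ≤ L) (x t : ℝ) :
    (1 - q * x) * blockEigenfun q L r (q * x) + (q ^ (L + 1) * x - t) * blockEigenfun q L r x =
      (q ^ r - t) * blockEigenfun q L r x := by
  obtain ⟨s, rfl⟩ := Nat.exists_eq_add_of_le hr
  simp only [blockEigenfun, Nat.add_sub_cancel_left]
  have h : (1 - q * x) * ∏ i ∈ Finset.range s, (1 - q ^ (i + 1) * (q * x)) =
      (∏ i ∈ Finset.range s, (1 - q ^ (i + 1) * x)) * (1 - q ^ (s + 1) * x) := by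
    rw [← Finset.prod_range_succ, Finset.prod_range_succ', mul_comm]
    congr 1
    · exact Finset.prod_congr rfl fun i _ => by ring
    · ring
  rw [mul_left_comm, h]
  ring

theorem blockEigenfun_nonneg {q x : ℝ} (hq : 0 ≤ q) (hq1 : q ≤ 1) (hx : 0 ≤ x) (hx1 : x ≤ 1)
    (L r : ℕ) : 0 ≤ blockEigenfun q L r x := by
  refine mul_nonneg (by positivity) (Finset.prod_nonneg fun i _ => ?_)
  have := mul_le_one₀ (pow_le_one₀ hq hq1 : q ^ (i + 1) ≤ 1) hx hx1
  linarith

/-- Replacing each `1 - q ^ (i + 1) * x` by the smaller `1 - x` turns the sum into the binomial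
expansion of `(x + (1 - x)) ^ L`. -/
theorem one_le_sum_blockEigenfun {q x : ℝ} (hq : 0 ≤ q) (hq1 : q ≤ 1) (hx : 0 ≤ x)
    (hx1 : x ≤ 1) (L : ℕ) :
    1 ≤ ∑ r ∈ Finset.range (L + 1), (L.choose r : ℝ) * blockEigenfun q L r x := by
  calc (1 : ℝ) = (x + (1 - x)) ^ L := by norm_num
    _ = ∑ r ∈ Finset.range (L + 1), x ^ r * (1 - x) ^ (L - r) * (L.choose r : ℝ) := add_pow _ _ _
    _ ≤ _ := by
      refine Finset.sum_le_sum fun r _ => ?_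
      rw [mul_comm]
      refine mul_le_mul_of_nonneg_left ?_ (by positivity)
      refine mul_le_mul_of_nonneg_left ?_ (by positivity)
      calc (1 - x) ^ (L - r) = ∏ i ∈ Finset.range (L - r), (1 - x) := by simp
        _ ≤ _ := Finset.prod_le_prod (fun _ _ => by linarith) fun i _ => by
          have := mul_le_of_le_one_left hx (pow_le_one₀ hq hq1 : q ^ (i + 1) ≤ 1)
          linarith

/-- The sum of an eigenfunction over the block positions, with Mallows weights. -/
noncomputable def blockMoment (q : ℝ) (L k r N : ℕ) : ℝ :=
  ∑ a ∈ Finset.range (N - L), blockWeight q N k (L + 1) a * blockEigenfun q L r (q ^ a)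

theorem blockMoment_succ_le {q : ℝ} (hq : 0 ≤ q) (hq1 : q ≤ 1) {L k r N : ℕ} (hr : r ≤ L)
    (hN : k + (L + 1) ≤ N) :
    (1 - q) * blockMoment q L k r (N + 1) ≤ (q ^ r - q ^ (N + 1)) * blockMoment q L k r N := by
  set φ := blockEigenfun q L r with hφ
  have hφ0 : ∀ a : ℕ, 0 ≤ φ (q ^ a) := fun a =>
    blockEigenfun_nonneg hq hq1 (by positivity) (pow_le_one₀ hq hq1) _ _
  set B := blockWeight q N k (L + 1) with hB
  set D : ℕ → ℝ := fun a => ∑ e ∈ Finset.Ico (a + (L + 1)) (N + 1), q ^ e with hD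
  have h1 : blockMoment q L k r (N + 1) ≤
      ∑ a ∈ Finset.range (N - L), qNat q (a + 1) * B a * φ (q ^ (a + 1)) +
      ∑ a ∈ Finset.range (N - L), D a * B a * φ (q ^ a) := by
    -- Appending the vanishing term `a = N - L` and splitting off `a = 0` aligns this sum with the
    -- targets `a + 1` of the recursion.
    have hlast : ∑ a ∈ Finset.range (N - L), D a * B a * φ (q ^ a) =
        ∑ a ∈ Finset.range (N - L), D (a + 1) * B (a + 1) * φ (q ^ (a + 1)) +
          D 0 * B 0 * φ (q ^ 0) := by
      rw [← Finset.sum_range_succ' (fun a => D a * B a * φ (q ^ a)), Finset.sum_range_succ]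
      have : D (N - L) = 0 := by
        simp only [hD]
        rw [Finset.Ico_eq_empty (by omega), Finset.sum_empty]
      rw [this]
      ring
    rw [hlast, ← add_assoc, ← Finset.sum_add_distrib, blockMoment,
      show N + 1 - L = N - L + 1 by omega, Finset.sum_range_succ']
    refine add_le_add (Finset.sum_le_sum fun a ha => ?_) ?_
    · rw [← add_mul]
      refine mul_le_mul_of_nonneg_right ?_ (hφ0 _)
      have := blockWeight_succ_succ_le hq hN a
      rw [min_eq_left (by have := Finset.mem_range.mp ha; omega)] at this
      exact this
    · refine mul_le_mul_of_nonneg_right ?_ (hφ0 _)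
      have := blockWeight_succ_zero_le hq hN
      simpa [hD] using this
  refine (mul_le_mul_of_nonneg_left h1 (by linarith)).trans_eq ?_
  rw [← Finset.sum_add_distrib, Finset.mul_sum, blockMoment, Finset.mul_sum]
  refine Finset.sum_congr rfl fun a ha => ?_
  have e1 := qNat_mul q (a + 1)
  have e2 : (1 - q) * D a = q ^ (a + (L + 1)) - q ^ (N + 1) :=
    mul_sum_Ico_pow q (by have := Finset.mem_range.mp ha; omega)
  have e3 := blockEigenfun_eq q hr (q ^ a) (q ^ (N + 1))
  rw [← hφ, ← pow_succ' q a] at e3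
  calc _ = ((1 - q) * qNat q (a + 1)) * B a * φ (q ^ (a + 1)) +
        ((1 - q) * D a) * B a * φ (q ^ a) := by ring
    _ = B a * ((1 - q ^ (a + 1)) * φ (q ^ (a + 1)) +
        (q ^ (L + 1) * q ^ a - q ^ (N + 1)) * φ (q ^ a)) := by rw [e1, e2]; ring
    _ = _ := by rw [e3]; ring

/-- The factor by which the normalized moment of the `r`-th eigenfunction changes while the
entries `K, …, n - 1` are inserted. -/
noncomputable def decayFactor (q : ℝ) (r K n : ℕ) : ℝ :=
  ∏ i ∈ Finset.Ico K n, (q ^ r - q ^ (i + 1)) / (1 - q ^ (i + 1))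

theorem decayFactor_nonneg {q : ℝ} (hq : 0 ≤ q) (hq1 : q ≤ 1) {r K : ℕ} (h : r ≤ K) (n : ℕ) :
    0 ≤ decayFactor q r K n := by
  refine Finset.prod_nonneg fun i hi => div_nonneg ?_ ?_
  · have := pow_le_pow_of_le_one hq hq1 (show r ≤ i + 1 by have := Finset.mem_Ico.mp hi; omega)
    linarith
  · have := pow_le_one₀ hq hq1 (n := i + 1)
    linarith

theorem blockMoment_div_le {q : ℝ} (hq : 0 < q) (hq1 : q < 1) {L k r n : ℕ} (hr : r ≤ L)
    (hn : k + (L + 1) ≤ n) :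
    blockMoment q L k r n / mallowsPartition n q ≤ decayFactor q r (k + (L + 1)) n *
      (blockMoment q L k r (k + (L + 1)) / mallowsPartition (k + (L + 1)) q) := by
  induction n, hn using Nat.le_induction with
  | base => simp [decayFactor]
  | succ n hn ih =>
    have hZ := mallowsPartition_pos hq n
    have hN := qNat_pos hq (Nat.succ_pos n)
    have h1 := blockMoment_succ_le hq.le hq1.le hr hn
    have hp : q ^ (n + 1) ≤ q ^ r := pow_le_pow_of_le_one hq.le hq1.le (by omega)
    have hp1 : q ^ (n + 1) < 1 := pow_lt_one₀ hq.le hq1 (by omega)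
    have hf : 0 ≤ (q ^ r - q ^ (n + 1)) / (1 - q ^ (n + 1)) :=
      div_nonneg (by linarith) (by linarith)
    have h2 : decayFactor q r (k + (L + 1)) (n + 1) = (q ^ r - q ^ (n + 1)) / (1 - q ^ (n + 1)) *
        decayFactor q r (k + (L + 1)) n := by
      rw [decayFactor, Finset.prod_Ico_succ_top hn, mul_comm, decayFactor]
    rw [h2, mul_assoc]
    refine le_trans ?_ (mul_le_mul_of_nonneg_left ih hf)
    rw [mallowsPartition_succ, qNat_eq_div hq1, div_mul_div_comm,
      div_le_div_iff₀ (mul_pos (div_pos (by linarith) (by linarith)) hZ)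
        (mul_pos (by linarith) hZ)]
    have hq' : (1 : ℝ) - q ≠ 0 := by linarith
    calc blockMoment q L k r (n + 1) * ((1 - q ^ (n + 1)) * mallowsPartition n q)
        = ((1 - q) * blockMoment q L k r (n + 1)) *
          ((1 - q ^ (n + 1)) / (1 - q) * mallowsPartition n q) := by field_simp
      _ ≤ _ := mul_le_mul_of_nonneg_right h1
          (mul_nonneg (div_nonneg (by linarith) (by linarith)) hZ.le)

theorem blockMoment_top_div_le {q : ℝ} (hq : 0 < q) (hq1 : q ≤ 1) (L k r : ℕ) :
    blockMoment q L k r (k + (L + 1)) / mallowsPartition (k + (L + 1)) q ≤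
      (∏ i ∈ Finset.range (L + 1), qNat q (i + 1) / qNat q (k + i + 1)) *
        ∑ a ∈ Finset.range (k + 1), q ^ ((L + 1) * a) * blockEigenfun q L r (q ^ a) := by
  have hZ := mallowsPartition_pos hq k
  have hprod : 0 < ∏ i ∈ Finset.range (L + 1), qNat q (k + i + 1) :=
    Finset.prod_pos fun i _ => qNat_pos hq (Nat.succ_pos _)
  have e : mallowsPartition (k + (L + 1)) q =
      mallowsPartition k q * ∏ i ∈ Finset.range (L + 1), qNat q (k + i + 1) := by
    rw [mallowsPartition_eq_prod, Finset.prod_range_add, ← mallowsPartition_eq_prod]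
  rw [e, div_le_iff₀ (mul_pos hZ hprod), Finset.prod_div_distrib, blockMoment,
    show k + (L + 1) - L = k + 1 by omega]
  have : ∀ X : ℝ, (∏ i ∈ Finset.range (L + 1), qNat q (i + 1)) /
      (∏ i ∈ Finset.range (L + 1), qNat q (k + i + 1)) * X *
      (mallowsPartition k q * ∏ i ∈ Finset.range (L + 1), qNat q (k + i + 1)) =
      (∏ i ∈ Finset.range (L + 1), qNat q (i + 1)) * mallowsPartition k q * X := by
    intro X
    field_simp
  rw [this, Finset.mul_sum]
  refine Finset.sum_le_sum fun a ha => ?_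
  rw [← mul_assoc]
  refine mul_le_mul_of_nonneg_right ?_
    (blockEigenfun_nonneg hq.le hq1 (by positivity) (pow_le_one₀ hq.le hq1) _ _)
  refine (blockWeight_top_le hq.le (L + 1) (by have := Finset.mem_range.mp ha; omega)).trans_eq ?_
  ring

/-- A bound on the probability of the cluster event that holds for all parameters. -/
theorem mallowsProb_clusterEvent_le_sum {q : ℝ} (hq : 0 < q) (hq1 : q < 1) {n L k : ℕ}
    (hn : k + (L + 1) ≤ n) :
    mallowsProb n q (clusterEvent n (L + 1) (k + 1)) ≤
      ∑ r ∈ Finset.range (L + 1), (L.choose r : ℝ) * (decayFactor q r (k + (L + 1)) n *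
        ((∏ i ∈ Finset.range (L + 1), qNat q (i + 1) / qNat q (k + i + 1)) *
          ∑ a ∈ Finset.range (k + 1), q ^ ((L + 1) * a) * blockEigenfun q L r (q ^ a))) := by
  have hZ := mallowsPartition_pos hq n
  calc _ ≤ (∑ a ∈ Finset.range (n + 1 - (L + 1)), blockWeight q n k (L + 1) a) /
        mallowsPartition n q := mallowsProb_clusterEvent_le hq hn
    _ ≤ (∑ r ∈ Finset.range (L + 1), (L.choose r : ℝ) * blockMoment q L k r n) /
        mallowsPartition n q := by
      refine div_le_div_of_nonneg_right ?_ hZ.le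
      simp only [blockMoment, Finset.mul_sum]
      rw [Finset.sum_comm, show n + 1 - (L + 1) = n - L by omega]
      refine Finset.sum_le_sum fun a _ => ?_
      have h := mul_le_mul_of_nonneg_left (one_le_sum_blockEigenfun hq.le hq1.le
        (by positivity) (pow_le_one₀ hq.le hq1.le : q ^ a ≤ 1) L)
        (blockWeight_nonneg hq.le n k (L + 1) a)
      rw [mul_one, Finset.mul_sum] at h
      exact h.trans_eq (Finset.sum_congr rfl fun r _ => by ring)
    _ = ∑ r ∈ Finset.range (L + 1), (L.choose r : ℝ) *
        (blockMoment q L k r n / mallowsPartition n q) := by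
      rw [Finset.sum_div]
      exact Finset.sum_congr rfl fun r _ => mul_div_assoc _ _ _
    _ ≤ _ := by
      refine Finset.sum_le_sum fun r hr => mul_le_mul_of_nonneg_left ?_ (by positivity)
      have hr : r ≤ L := by have := Finset.mem_range.mp hr; omega
      exact (blockMoment_div_le hq hq1 hr hn).trans (mul_le_mul_of_nonneg_left
        (blockMoment_top_div_le hq hq1.le L k r) (decayFactor_nonneg hq.le hq1.le (by omega) n))

/-! ### Decay factors and the resummed bound -/

/-- The value `q ^ (n - K) (1 - q ^ K) / (1 - q ^ n)` of the first decay factor. -/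
noncomputable def decayBase (q : ℝ) (K n : ℕ) : ℝ := q ^ (n - K) * (1 - q ^ K) / (1 - q ^ n)

/-- Since `q ^ r - q ^ (i + 1) = q ^ r * (1 - q ^ (i + 1 - r))`, the product telescopes up to `r`
factors at each end. -/
theorem decayFactor_mul_prod {q : ℝ} (hq : 0 < q) (hq1 : q < 1) {r K n : ℕ} (hr : r ≤ K)
    (hn : K ≤ n) :
    decayFactor q r K n * ∏ s ∈ Finset.range r, (1 - q ^ (n - s)) =
      q ^ (r * (n - K)) * ∏ s ∈ Finset.range r, (1 - q ^ (K - s)) := by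
  induction n, hn using Nat.le_induction with
  | base => simp [decayFactor]
  | succ n hn ih =>
    have hp1 : 1 - q ^ (n + 1) ≠ 0 := by
      have := pow_lt_one₀ hq.le hq1 (show n + 1 ≠ 0 by omega)
      linarith
    have h1 : (1 - q ^ (n + 1 - r)) * ∏ s ∈ Finset.range r, (1 - q ^ (n + 1 - s)) =
        (1 - q ^ (n + 1)) * ∏ s ∈ Finset.range r, (1 - q ^ (n - s)) := by
      rw [mul_comm, ← Finset.prod_range_succ (fun s => 1 - q ^ (n + 1 - s)),
        Finset.prod_range_succ', mul_comm]
      congr 1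
      exact Finset.prod_congr rfl fun s _ => by rw [Nat.add_sub_add_right]
    have h2 : q ^ r - q ^ (n + 1) = q ^ r * (1 - q ^ (n + 1 - r)) := by
      rw [mul_sub, ← pow_add, mul_one]
      congr 2
      omega
    rw [decayFactor, Finset.prod_Ico_succ_top hn, ← decayFactor, h2]
    calc _ = decayFactor q r K n * q ^ r / (1 - q ^ (n + 1)) *
          ((1 - q ^ (n + 1 - r)) * ∏ s ∈ Finset.range r, (1 - q ^ (n + 1 - s))) := by ring
      _ = q ^ r * (decayFactor q r K n * ∏ s ∈ Finset.range r, (1 - q ^ (n - s))) := by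
        rw [h1]; field_simp
      _ = _ := by
        rw [ih, show n + 1 - K = n - K + 1 by omega, Nat.mul_add, pow_add]
        ring

theorem decayFactor_one {q : ℝ} (hq : 0 < q) (hq1 : q < 1) {K n : ℕ} (hK : 0 < K)
    (hn : K ≤ n) : decayFactor q 1 K n = decayBase q K n := by
  have h := decayFactor_mul_prod (r := 1) hq hq1 hK hn
  simp only [Finset.prod_range_one, Nat.sub_zero, one_mul] at h
  have := pow_lt_one₀ hq.le hq1 (show n ≠ 0 by omega)
  rw [decayBase, eq_div_iff (by linarith), h]

theorem decayFactor_le_pow {q : ℝ} (hq : 0 < q) (hq1 : q < 1) {r K n : ℕ} (hr : r ≤ K)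
    (hK : 0 < K) (hn : K ≤ n) : decayFactor q r K n ≤ decayBase q K n ^ r := by
  rw [← decayFactor_one hq hq1 hK hn, decayFactor, decayFactor, ← Finset.prod_pow]
  refine Finset.prod_le_prod (fun i hi => ?_) fun i hi => ?_
  · have hi := Finset.mem_Ico.mp hi
    have h1 := pow_le_pow_of_le_one hq.le hq1.le (show r ≤ i + 1 by omega)
    have h2 := pow_le_one₀ hq.le hq1.le (n := i + 1)
    exact div_nonneg (by linarith) (by linarith)
  · have hi := Finset.mem_Ico.mp hi
    have ht := pow_lt_one₀ hq.le hq1 (show i + 1 ≠ 0 by omega)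
    have ht0 : 0 < q ^ (i + 1) := by positivity
    have htq : q ^ (i + 1) ≤ q := pow_le_of_le_one hq.le hq1.le (by omega)
    generalize q ^ (i + 1) = t at *
    clear hi hr
    rw [pow_one]
    induction r with
    | zero => rw [pow_zero, pow_zero, div_self (by linarith)]
    | succ r ih =>
      rw [pow_succ ((q - t) / (1 - t))]
      refine le_trans ?_ (mul_le_mul_of_nonneg_right ih (div_nonneg (by linarith) (by linarith)))
      rw [div_mul_div_comm, div_le_div_iff₀ (by linarith)
        (mul_pos (by linarith) (by linarith))]
      -- The two sides differ by exactly `t * (1 - q) * (1 - q ^ r)`.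
      have h : (q ^ (r + 1) - t) * (1 - t) ≤ (q ^ r - t) * (q - t) := by
        have hr1 : q ^ r ≤ 1 := pow_le_one₀ hq.le hq1.le
        have : 0 ≤ t * ((1 - q) * (1 - q ^ r)) :=
          mul_nonneg ht0.le (mul_nonneg (by linarith) (by linarith))
        rw [pow_succ]
        nlinarith
      calc _ = ((q ^ (r + 1) - t) * (1 - t)) * (1 - t) := by ring
        _ ≤ _ := mul_le_mul_of_nonneg_right h (by linarith)

theorem blockEigenfun_le {q x : ℝ} (hq : 0 ≤ q) (hq1 : q ≤ 1) (hx : 0 ≤ x) (hx1 : x ≤ 1)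
    (L r : ℕ) : blockEigenfun q L r x ≤ x ^ r * (1 - q ^ (L + 1) * x) ^ (L - r) := by
  refine mul_le_mul_of_nonneg_left ?_ (by positivity)
  calc _ ≤ ∏ i ∈ Finset.range (L - r), (1 - q ^ (L + 1) * x) := by
        refine Finset.prod_le_prod (fun i _ => ?_) fun i hi => ?_
        · have := mul_le_one₀ (pow_le_one₀ hq hq1 : q ^ (i + 1) ≤ 1) hx hx1
          linarith
        · have := mul_le_mul_of_nonneg_right (pow_le_pow_of_le_one hq hq1
            (show i + 1 ≤ L + 1 by have := Finset.mem_range.mp hi; omega)) hx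
          linarith
    _ = _ := by simp

theorem qNat_nonneg {q : ℝ} (hq : 0 ≤ q) (j : ℕ) : 0 ≤ qNat q j :=
  Finset.sum_nonneg fun _ _ => by positivity

theorem qNat_le {q : ℝ} (hq : 0 ≤ q) (hq1 : q ≤ 1) (j : ℕ) : qNat q j ≤ j := by
  calc qNat q j ≤ ∑ i ∈ Finset.range j, (1 : ℝ) :=
        Finset.sum_le_sum fun i _ => pow_le_one₀ hq hq1
    _ = j := by simp

theorem pow_mul_le_qNat {q : ℝ} (hq : 0 ≤ q) (hq1 : q ≤ 1) {j n : ℕ} (h : j ≤ n) :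
    q ^ n * j ≤ qNat q j := by
  calc q ^ n * j = ∑ i ∈ Finset.range j, q ^ n := by simp [mul_comm]
    _ ≤ _ := Finset.sum_le_sum fun i hi =>
      pow_le_pow_of_le_one hq hq1 (by have := Finset.mem_range.mp hi; omega)

theorem prod_qNat_le_factorial {q : ℝ} (hq : 0 ≤ q) (hq1 : q ≤ 1) (l : ℕ) :
    ∏ i ∈ Finset.range l, qNat q (i + 1) ≤ (l.factorial : ℝ) := by
  rw [← Finset.prod_range_add_one_eq_factorial, Nat.cast_prod]
  exact Finset.prod_le_prod (fun i _ => qNat_nonneg hq _) fun i _ => qNat_le hq hq1 _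

/-- The bound behind the case of linear growth of `k`. -/
theorem mallowsProb_clusterEvent_le_sum_pow {q : ℝ} (hq : 0 < q) (hq1 : q < 1) {n L k : ℕ}
    (hn : k + (L + 1) ≤ n) :
    mallowsProb n q (clusterEvent n (L + 1) (k + 1)) ≤
      (∏ i ∈ Finset.range (L + 1), qNat q (i + 1) / qNat q (k + i + 1)) *
        ∑ a ∈ Finset.range (k + 1), (q ^ a) ^ (L + 1) *
          (1 - (q ^ (L + 1) - decayBase q (k + (L + 1)) n) * q ^ a) ^ L := by
  refine (mallowsProb_clusterEvent_le_sum hq hq1 hn).trans ?_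
  set P := ∏ i ∈ Finset.range (L + 1), qNat q (i + 1) / qNat q (k + i + 1) with hP
  have hP0 : 0 ≤ P :=
    Finset.prod_nonneg fun i _ => div_nonneg (qNat_nonneg hq.le _) (qNat_nonneg hq.le _)
  set E := decayBase q (k + (L + 1)) n with hE
  calc _ = P * ∑ a ∈ Finset.range (k + 1), ∑ r ∈ Finset.range (L + 1), (q ^ a) ^ (L + 1) *
        ((L.choose r : ℝ) * (decayFactor q r (k + (L + 1)) n * blockEigenfun q L r (q ^ a))) := by
        rw [Finset.sum_comm, Finset.mul_sum]
        refine Finset.sum_congr rfl fun r _ => ?_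
        rw [mul_left_comm _ P, mul_left_comm _ P, Finset.mul_sum, Finset.mul_sum]
        congr 1
        refine Finset.sum_congr rfl fun a _ => ?_
        rw [mul_comm (L + 1) a, pow_mul]
        ring
    _ ≤ _ := by
        refine mul_le_mul_of_nonneg_left (Finset.sum_le_sum fun a _ => ?_) hP0
        rw [← Finset.mul_sum]
        refine mul_le_mul_of_nonneg_left ?_ (by positivity)
        rw [show 1 - (q ^ (L + 1) - E) * q ^ a = E * q ^ a + (1 - q ^ (L + 1) * q ^ a) by ring,
          add_pow]
        refine Finset.sum_le_sum fun r hr => ?_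
        have hr : r ≤ L := by have := Finset.mem_range.mp hr; omega
        have hx1 : q ^ a ≤ 1 := pow_le_one₀ hq.le hq1.le
        rw [mul_comm]
        refine mul_le_mul_of_nonneg_right ?_ (by positivity)
        have h0 := decayFactor_nonneg hq.le hq1.le (show r ≤ k + (L + 1) by omega) n
        have h1 := decayFactor_le_pow hq hq1 (show r ≤ k + (L + 1) by omega) (by omega) hn
        refine (mul_le_mul h1 (blockEigenfun_le hq.le hq1.le (by positivity) hx1 L r)
          (blockEigenfun_nonneg hq.le hq1.le (by positivity) hx1 L r) (h0.trans h1)).trans_eq ?_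
        rw [mul_pow]
        ring

/-! ### Bounds uniform in the location of the block -/

theorem decayBase_le {q : ℝ} (hq : 0 < q) (hq1 : q < 1) {K n : ℕ} (hK : 0 < K) (hn : K ≤ n) :
    decayBase q K n ≤ K / (q ^ n * n) := by
  have hn0 : (0 : ℝ) < n := by exact_mod_cast hK.trans_le hn
  have h1 := qNat_pos hq (hK.trans_le hn)
  calc decayBase q K n = q ^ (n - K) * qNat q K / qNat q n := by
        have : (1 : ℝ) - q ≠ 0 := by linarith
        rw [decayBase, ← qNat_mul, ← qNat_mul]
        field_simp
    _ ≤ K / (q ^ n * n) := by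
        refine div_le_div₀ (by positivity) ?_ (by positivity) (pow_mul_le_qNat hq.le hq1.le le_rfl)
        exact (mul_le_of_le_one_left (qNat_nonneg hq.le _) (pow_le_one₀ hq.le hq1.le)).trans
          (qNat_le hq.le hq1.le K)

/-- Every factor after the first is at least `(k + L + 1) / (L + 1)`. The loss of a constant is
harmless, since this serves only the terms that vanish in the limit. -/
theorem mul_pow_le_prod (k L : ℕ) :
    ((k : ℝ) + 1) * (((k + (L + 1) : ℕ) : ℝ) / (L + 1)) ^ L ≤
      ∏ i ∈ Finset.range (L + 1), ((k + i + 1 : ℕ) : ℝ) := by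
  rw [Finset.prod_range_succ', mul_comm]
  refine mul_le_mul ?_ (by push_cast; linarith) (by positivity)
    (Finset.prod_nonneg fun i _ => by positivity)
  calc _ = ∏ i ∈ Finset.range L, (((k + (L + 1) : ℕ) : ℝ) / (L + 1)) := by
        rw [Finset.prod_const, Finset.card_range]
    _ ≤ _ := Finset.prod_le_prod (fun i _ => by positivity) fun i _ => by
      rw [div_le_iff₀ (by positivity)]
      push_cast
      have : (0 : ℝ) ≤ k * L := by positivity
      have : (0 : ℝ) ≤ i * (L + 1) := by positivity
      nlinarith

theorem prod_qNat_div_mul_le {q : ℝ} (hq : 0 < q) (hq1 : q < 1) {n L k : ℕ}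
    (hn : k + (L + 1) ≤ n) :
    (∏ i ∈ Finset.range (L + 1), qNat q (i + 1) / qNat q (k + i + 1)) * (k + 1) ≤
      (L + 1).factorial * ((L + 1) / (k + (L + 1) : ℕ)) ^ L / (q ^ n) ^ (L + 1) := by
  have hpos : 0 < ∏ i ∈ Finset.range (L + 1), qNat q (k + i + 1) :=
    Finset.prod_pos fun i _ => qNat_pos hq (Nat.succ_pos _)
  have h1 : (q ^ n) ^ (L + 1) * (((k : ℝ) + 1) * (((k + (L + 1) : ℕ) : ℝ) / (L + 1)) ^ L) ≤
      ∏ i ∈ Finset.range (L + 1), qNat q (k + i + 1) := by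
    refine (mul_le_mul_of_nonneg_left (mul_pow_le_prod k L) (by positivity)).trans ?_
    have e : (q ^ n) ^ (L + 1) = ∏ _i ∈ Finset.range (L + 1), q ^ n := by simp
    rw [e, ← Finset.prod_mul_distrib]
    exact Finset.prod_le_prod (fun i _ => by positivity) fun i hi =>
      pow_mul_le_qNat hq.le hq1.le (by have := Finset.mem_range.mp hi; omega)
  have hK : (0 : ℝ) < ((k + (L + 1) : ℕ) : ℝ) := by positivity
  rw [Finset.prod_div_distrib, div_mul_eq_mul_div, div_le_iff₀ hpos]
  calc _ ≤ ((L + 1).factorial : ℝ) * (k + 1) :=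
        mul_le_mul_of_nonneg_right (prod_qNat_le_factorial hq.le hq1.le _) (by positivity)
    _ = (L + 1).factorial * ((L + 1) / (k + (L + 1) : ℕ)) ^ L / (q ^ n) ^ (L + 1) *
        ((q ^ n) ^ (L + 1) * (((k : ℝ) + 1) * (((k + (L + 1) : ℕ) : ℝ) / (L + 1)) ^ L)) := by
        rw [div_pow, div_pow]
        field_simp
    _ ≤ _ := mul_le_mul_of_nonneg_left h1 (by positivity)

theorem one_sub_pow_le {q : ℝ} (hq : 0 ≤ q) (hq1 : q ≤ 1) (j : ℕ) :
    1 - q ^ j ≤ j * (1 - q) := by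
  rw [← qNat_mul, mul_comm]
  exact mul_le_mul_of_nonneg_right (qNat_le hq hq1 j) (by linarith)

/-- With `K = k + L + 1`, the decay factor contributes `K ^ r` and the eigenfunction `K ^ (L - r)`;
together they cancel the `K ^ L` in the denominator of the prefactor, which removes `k`. -/
theorem lower_term_le {q : ℝ} (hq : 0 < q) (hq1 : q < 1) {n L k r : ℕ}
    (hn : k + (L + 1) ≤ n) (hr : r ≤ L) :
    decayFactor q r (k + (L + 1)) n *
      ((∏ i ∈ Finset.range (L + 1), qNat q (i + 1) / qNat q (k + i + 1)) *
        ∑ a ∈ Finset.range (k + 1), q ^ ((L + 1) * a) * blockEigenfun q L r (q ^ a)) ≤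
      (L + 1).factorial * (L + 1) ^ L * (n * (1 - q)) ^ (L - r) / (q ^ n) ^ (L + 1 + r) /
        n ^ L := by
  set K := k + (L + 1) with hKdef
  have hK : (0 : ℝ) < K := by rw [hKdef]; positivity
  have hn0 : (0 : ℝ) < n := by exact_mod_cast (show 0 < n by omega)
  have hsum : ∑ a ∈ Finset.range (k + 1), q ^ ((L + 1) * a) * blockEigenfun q L r (q ^ a) ≤
      (k + 1) * (K * (1 - q)) ^ (L - r) := by
    calc _ ≤ ∑ a ∈ Finset.range (k + 1), (K * (1 - q)) ^ (L - r) := by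
          refine Finset.sum_le_sum fun a ha => ?_
          have ha := Finset.mem_range.mp ha
          have hx1 : q ^ a ≤ 1 := pow_le_one₀ hq.le hq1.le
          have hφ0 := blockEigenfun_nonneg hq.le hq1.le (by positivity) hx1 L r
          refine (mul_le_of_le_one_left hφ0 (pow_le_one₀ hq.le hq1.le)).trans ?_
          refine (blockEigenfun_le hq.le hq1.le (by positivity) hx1 L r).trans ?_
          have hy : q ^ (L + 1) * q ^ a ≤ 1 := by
            rw [← pow_add]; exact pow_le_one₀ hq.le hq1.le
          refine (mul_le_of_le_one_left (pow_nonneg (by linarith) _)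
            (pow_le_one₀ (by positivity) hx1)).trans ?_
          refine pow_le_pow_left₀ (by linarith) ?_ _
          refine le_trans ?_ (one_sub_pow_le hq.le hq1.le K)
          rw [← pow_add]
          have := pow_le_pow_of_le_one hq.le hq1.le (show L + 1 + a ≤ K by omega)
          linarith
      _ = _ := by simp
  have hP0 : 0 ≤ ∏ i ∈ Finset.range (L + 1), qNat q (i + 1) / qNat q (k + i + 1) :=
    Finset.prod_nonneg fun i _ => div_nonneg (qNat_nonneg hq.le _) (qNat_nonneg hq.le _)
  have hΛ : decayFactor q r K n ≤ (K / (q ^ n * n)) ^ r := by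
    refine (decayFactor_le_pow hq hq1 (by omega) (by omega) hn).trans ?_
    refine pow_le_pow_left₀ ?_ (decayBase_le hq hq1 (by omega) hn) _
    rw [← decayFactor_one hq hq1 (by omega) hn]
    exact decayFactor_nonneg hq.le hq1.le (by omega) n
  have hq1' : 0 ≤ 1 - q := by linarith
  calc _ ≤ (K / (q ^ n * n)) ^ r *
        (((L + 1).factorial * ((L + 1) / (K : ℕ)) ^ L / (q ^ n) ^ (L + 1)) *
          (K * (1 - q)) ^ (L - r)) := by
        refine mul_le_mul hΛ ?_ (mul_nonneg hP0 (Finset.sum_nonneg fun a _ =>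
          mul_nonneg (by positivity) (blockEigenfun_nonneg hq.le hq1.le (by positivity)
            (pow_le_one₀ hq.le hq1.le) L r))) (by positivity)
        refine (mul_le_mul_of_nonneg_left hsum hP0).trans ?_
        rw [← mul_assoc]
        exact mul_le_mul_of_nonneg_right (prod_qNat_div_mul_le hq hq1 hn) (by positivity)
    _ = _ := by
        obtain ⟨s, rfl⟩ := Nat.exists_eq_add_of_le hr
        rw [Nat.add_sub_cancel_left, div_pow, div_pow, mul_pow, mul_pow, mul_pow,
          pow_add _ (r + s + 1) r, pow_add (K : ℝ) r s, pow_add (n : ℝ) r s]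
        field_simp

/-- No constant may be lost here, so the telescoped decay factor is used. Its numerator `A` cancels
all but `qNat q (k + 1)` of the prefactor's denominator, and that is balanced by the `k + 1`
summands. -/
theorem top_term_le {q : ℝ} (hq : 0 < q) (hq1 : q < 1) {n L k : ℕ} (hn : k + (L + 1) ≤ n) :
    decayFactor q L (k + (L + 1)) n *
      ((∏ i ∈ Finset.range (L + 1), qNat q (i + 1) / qNat q (k + i + 1)) *
        ∑ a ∈ Finset.range (k + 1), q ^ ((L + 1) * a) * blockEigenfun q L L (q ^ a)) ≤
      (L + 1).factorial / (q ^ n) ^ (L + 1) / ((n : ℝ) - L) ^ L := by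
  set K := k + (L + 1) with hKdef
  have hnL : (0 : ℝ) < (n : ℝ) - L := by
    have : (L : ℝ) < n := by exact_mod_cast (show L < n by omega)
    linarith
  have hΛ0 := decayFactor_nonneg hq.le hq1.le (show L ≤ K by omega) n
  have hP0 : 0 ≤ ∏ i ∈ Finset.range (L + 1), qNat q (i + 1) / qNat q (k + i + 1) :=
    Finset.prod_nonneg fun i _ => div_nonneg (qNat_nonneg hq.le _) (qNat_nonneg hq.le _)
  have hsum : ∑ a ∈ Finset.range (k + 1), q ^ ((L + 1) * a) * blockEigenfun q L L (q ^ a) ≤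
      k + 1 := by
    calc _ ≤ ∑ a ∈ Finset.range (k + 1), (1 : ℝ) := by
          refine Finset.sum_le_sum fun a ha => mul_le_one₀ (pow_le_one₀ hq.le hq1.le)
            (blockEigenfun_nonneg hq.le hq1.le (by positivity) (pow_le_one₀ hq.le hq1.le) _ _) ?_
          simpa [blockEigenfun] using pow_le_one₀ (by positivity) (pow_le_one₀ hq.le hq1.le)
      _ = _ := by simp
  set A := ∏ s ∈ Finset.range L, qNat q (K - s) with hA
  set B := ∏ s ∈ Finset.range L, qNat q (n - s) with hB
  have hA0 : 0 < A := Finset.prod_pos fun s hs => qNat_pos hq (by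
    have := Finset.mem_range.mp hs; omega)
  have hB0 : 0 < B := Finset.prod_pos fun s hs => qNat_pos hq (by
    have := Finset.mem_range.mp hs; omega)
  have hΛ : decayFactor q L K n ≤ A / B := by
    have h := decayFactor_mul_prod hq hq1 (show L ≤ K by omega) hn
    simp only [← qNat_mul, Finset.prod_mul_distrib, Finset.prod_const, Finset.card_range] at h
    have hne : 0 < (1 - q) ^ L := pow_pos (by linarith) _
    rw [le_div_iff₀ hB0]
    have h2 : decayFactor q L K n * B = q ^ (L * (n - K)) * A := by
      apply mul_left_cancel₀ hne.ne'
      rw [mul_left_comm, h]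
      ring
    rw [h2]
    exact mul_le_of_le_one_left hA0.le (pow_le_one₀ hq.le hq1.le)
  have hk0 := qNat_pos hq (Nat.succ_pos k)
  have hP : (∏ i ∈ Finset.range (L + 1), qNat q (i + 1) / qNat q (k + i + 1)) =
      (∏ i ∈ Finset.range (L + 1), qNat q (i + 1)) / (A * qNat q (k + 1)) := by
    rw [Finset.prod_div_distrib]
    congr 1
    rw [Finset.prod_range_succ' (fun i => qNat q (k + i + 1)), hA, ← Finset.prod_range_reflect]
    congr 1
    refine Finset.prod_congr rfl fun s hs => ?_
    congr 1
    have := Finset.mem_range.mp hs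
    omega
  have hBge : (q ^ n * ((n : ℝ) - L)) ^ L ≤ B := by
    calc _ = ∏ s ∈ Finset.range L, (q ^ n * ((n : ℝ) - L)) := by simp
      _ ≤ _ := Finset.prod_le_prod (fun s _ => by positivity) fun s hs => by
        have hs := Finset.mem_range.mp hs
        refine le_trans ?_ (pow_mul_le_qNat hq.le hq1.le (Nat.sub_le n s))
        refine mul_le_mul_of_nonneg_left ?_ (by positivity)
        rw [Nat.cast_sub (by omega)]
        have : (s : ℝ) ≤ L := by exact_mod_cast hs.le
        linarith
  calc _ ≤ A / B * ((∏ i ∈ Finset.range (L + 1), qNat q (i + 1) / qNat q (k + i + 1)) *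
        (k + 1)) := by
        refine mul_le_mul hΛ (mul_le_mul_of_nonneg_left hsum hP0) (mul_nonneg hP0
          (Finset.sum_nonneg fun a _ => mul_nonneg (by positivity) (blockEigenfun_nonneg hq.le
            hq1.le (by positivity) (pow_le_one₀ hq.le hq1.le) L L))) (by positivity)
    _ = (∏ i ∈ Finset.range (L + 1), qNat q (i + 1)) * ((k + 1) / qNat q (k + 1)) / B := by
        rw [hP]
        field_simp
    _ ≤ ((L + 1).factorial : ℝ) * (1 / q ^ n) / (q ^ n * ((n : ℝ) - L)) ^ L := by
        refine div_le_div₀ (by positivity) ?_ (by positivity) hBge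
        refine mul_le_mul (prod_qNat_le_factorial hq.le hq1.le _) ?_ (by positivity)
          (by positivity)
        rw [div_le_div_iff₀ hk0 (by positivity), one_mul, mul_comm]
        have := pow_mul_le_qNat hq.le hq1.le (show k + 1 ≤ n by omega)
        exact_mod_cast this
    _ = _ := by
        rw [mul_pow, pow_succ (q ^ n)]
        field_simp

/-! ### Limit tools and the comparison of integrals -/

theorem asympLE_of_tendsto {a b U : ℕ → ℝ} {v : ℝ} (h : ∀ᶠ n in atTop, a n / b n ≤ U n)
    (hU : Tendsto U atTop (𝓝 v)) (hv : v ≤ 1) : AsympLE a b := by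
  have hU' : Tendsto (fun n => ((U n : ℝ) : EReal)) atTop (𝓝 (v : EReal)) :=
    (continuous_coe_real_ereal.tendsto v).comp hU
  calc limsup (fun n => ((a n / b n : ℝ) : EReal)) atTop
      ≤ limsup (fun n => ((U n : ℝ) : EReal)) atTop :=
        limsup_le_limsup (h.mono fun n hn => EReal.coe_le_coe_iff.mpr hn)
    _ = v := hU'.limsup_eq
    _ ≤ 1 := by exact_mod_cast hv

theorem tendsto_pow_of_tendsto_mul_log {q : ℕ → ℝ} {m : ℕ → ℕ} {t x : ℝ}
    (hpos : ∀ᶠ n in atTop, 0 < q n)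
    (hq : Tendsto (fun n : ℕ => (n : ℝ) * Real.log (q n)) atTop (𝓝 t))
    (hm : Tendsto (fun n : ℕ => (m n : ℝ) / n) atTop (𝓝 x)) :
    Tendsto (fun n => q n ^ m n) atTop (𝓝 (Real.exp (t * x))) := by
  refine ((Real.continuous_exp.tendsto _).comp (hq.mul hm)).congr' ?_
  filter_upwards [hpos, eventually_gt_atTop 0] with n hn hn0
  have : (n : ℝ) ≠ 0 := by positivity
  rw [Function.comp_apply, ← Real.rpow_natCast, Real.rpow_def_of_pos hn]
  congr 1
  field_simp

theorem tendsto_qNat {q : ℕ → ℝ} (hq : Tendsto q atTop (𝓝 1)) (j : ℕ) :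
    Tendsto (fun n => qNat (q n) j) atTop (𝓝 (j : ℝ)) := by
  have h : Tendsto (fun n => ∑ i ∈ Finset.range j, q n ^ i) atTop
      (𝓝 (∑ i ∈ Finset.range j, (1 : ℝ) ^ i)) := tendsto_finsetSum _ fun i _ => hq.pow i
  simpa [qNat] using h

/-- The pointwise comparison of the integrand of the exact limit with the exponential. -/
theorem one_sub_mul_le_exp {c d y : ℝ} (hc : 0 < c) (hd : 0 < d)
    (hy : Real.exp (-(c * d)) ≤ y) :
    1 - (1 - Real.exp (-(c * (1 - d))) * (1 - Real.exp (-(c * d))) / (1 - Real.exp (-c))) * y ≤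
      Real.exp (clusterGamma c d * Real.exp (c * d) * y) := by
  set u := Real.exp (-(c * d)) with hu
  set v := Real.exp (-c) with hv
  have hu0 : 0 < u := Real.exp_pos _
  have hv0 : 0 < v := Real.exp_pos _
  have hcd : 0 < c * d := by positivity
  have hu1 : u < 1 := Real.exp_lt_one_iff.mpr (by linarith)
  have hv1 : v < 1 := Real.exp_lt_one_iff.mpr (by linarith)
  have hw : Real.exp (-(c * (1 - d))) = v / u := by
    rw [hu, hv, ← Real.exp_sub]; ring_nf
  have hinv : Real.exp (c * d) = u⁻¹ := by rw [hu, ← Real.exp_neg, neg_neg]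
  set g := (1 - u) / (1 - v) with hg
  have hg0 : 0 < g := div_pos (by linarith) (by linarith)
  have hv1' : 1 - v ≠ 0 := by linarith
  have hγ : clusterGamma c d = Real.log g := rfl
  -- Expansion at `y = u`, where both sides equal `g`. The left side is affine of slope `(g - 1) /
  -- u`, the tangent of the right has slope `g * log g / u`, and the exponential lies above its
  -- tangent.
  have e1 : clusterGamma c d * Real.exp (c * d) * y =
      Real.log g + Real.log g * ((y - u) / u) := by
    rw [hγ, hinv]; field_simp; ring
  have hlog : g - 1 ≤ g * Real.log g := by
    have := Real.one_sub_inv_le_log_of_pos hg0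
    calc g - 1 = g * (1 - g⁻¹) := by field_simp
      _ ≤ _ := mul_le_mul_of_nonneg_left this hg0.le
  have hyu : 0 ≤ (y - u) / u := div_nonneg (by linarith) hu0.le
  rw [e1, Real.exp_add, Real.exp_log hg0, hw]
  calc _ = g + (g - 1) * ((y - u) / u) := by
        rw [hg]; field_simp; ring
    _ ≤ g + (g * Real.log g) * ((y - u) / u) := by
        linarith [mul_le_mul_of_nonneg_right hlog hyu]
    _ = g * (Real.log g * ((y - u) / u) + 1) := by ring
    _ ≤ _ := mul_le_mul_of_nonneg_left (Real.add_one_le_exp _) hg0.le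

theorem integral_pow_mul_pow (L : ℕ) (u b : ℝ) :
    ∫ y in u..1, y ^ L * (1 - b * y) ^ L =
      ∑ r ∈ Finset.range (L + 1), (L.choose r : ℝ) *
        ((-b) ^ r * ((1 - u ^ (L + 1 + r)) / (L + 1 + r : ℕ))) := by
  have h : ∀ y : ℝ, y ^ L * (1 - b * y) ^ L =
      ∑ r ∈ Finset.range (L + 1), ((L.choose r : ℝ) * (-b) ^ r) * y ^ (L + r) := by
    intro y
    rw [show 1 - b * y = -b * y + 1 by ring, add_pow, Finset.mul_sum]
    refine Finset.sum_congr rfl fun r _ => ?_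
    rw [mul_pow]
    ring
  simp_rw [h]
  rw [intervalIntegral.integral_finsetSum fun r _ =>
    (by fun_prop : Continuous _).intervalIntegrable _ _]
  refine Finset.sum_congr rfl fun r _ => ?_
  rw [intervalIntegral.integral_const_mul, integral_pow, one_pow, mul_assoc,
    show L + 1 + r = L + r + 1 by ring]
  push_cast
  ring

theorem integral_le_integral_exp {c d : ℝ} (hc : 0 < c) (hd : 0 < d) (L : ℕ) :
    ∫ y in (Real.exp (-(c * d)))..1, y ^ L * (1 - (1 - Real.exp (-(c * (1 - d))) *
        (1 - Real.exp (-(c * d))) / (1 - Real.exp (-c))) * y) ^ L ≤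
      ∫ y in (Real.exp (-(c * d)))..1,
        y ^ L * Real.exp (clusterGamma c d * Real.exp (c * d) * L * y) := by
  have hcd : 0 < c * d := by positivity
  have hu1 : Real.exp (-(c * d)) < 1 := Real.exp_lt_one_iff.mpr (by linarith)
  have hv1 : Real.exp (-c) < 1 := Real.exp_lt_one_iff.mpr (by linarith)
  have hu0 : 0 < Real.exp (-(c * d)) := Real.exp_pos _
  refine intervalIntegral.integral_mono_on hu1.le
    ((by fun_prop : Continuous _).intervalIntegrable _ _)
    ((by fun_prop : Continuous _).intervalIntegrable _ _) fun y hy => ?_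
  refine mul_le_mul_of_nonneg_left ?_ (pow_nonneg (hu0.le.trans hy.1) _)
  rw [show clusterGamma c d * Real.exp (c * d) * L * y =
    L * (clusterGamma c d * Real.exp (c * d) * y) by ring, Real.exp_nat_mul]
  refine pow_le_pow_left₀ ?_ (one_sub_mul_le_exp hc hd hy.1) _
  have hE : 0 ≤ Real.exp (-(c * (1 - d))) * (1 - Real.exp (-(c * d))) / (1 - Real.exp (-c)) :=
    div_nonneg (mul_nonneg (Real.exp_pos _).le (by linarith)) (by linarith)
  have : 0 ≤ y * (Real.exp (-(c * (1 - d))) * (1 - Real.exp (-(c * d))) / (1 - Real.exp (-c))) :=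
    mul_nonneg (hu0.le.trans hy.1) hE
  nlinarith [hy.2]

/-- The bound of `mallowsProb_clusterEvent_le_sum_pow`, with the geometric sums evaluated. -/
theorem mallowsProb_clusterEvent_le_expanded {q : ℝ} (hq : 0 < q) (hq1 : q < 1) {n L k : ℕ}
    (hn : k + (L + 1) ≤ n) :
    mallowsProb n q (clusterEvent n (L + 1) (k + 1)) ≤
      (1 - q) ^ L * ((∏ i ∈ Finset.range (L + 1), qNat q (i + 1) / (1 - q ^ (k + i + 1))) *
        ∑ r ∈ Finset.range (L + 1), (L.choose r : ℝ) *
          ((decayBase q (k + (L + 1)) n - q ^ (L + 1)) ^ r *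
            ((1 - (q ^ (k + 1)) ^ (L + 1 + r)) / qNat q (L + 1 + r)))) := by
  refine (mallowsProb_clusterEvent_le_sum_pow hq hq1 hn).trans_eq ?_
  set E := decayBase q (k + (L + 1)) n
  have hq' : (1 : ℝ) - q ≠ 0 := by linarith
  have h1 : (∏ i ∈ Finset.range (L + 1), qNat q (i + 1) / qNat q (k + i + 1)) =
      (1 - q) ^ (L + 1) *
        ∏ i ∈ Finset.range (L + 1), qNat q (i + 1) / (1 - q ^ (k + i + 1)) := by
    have e : (1 - q) ^ (L + 1) = ∏ _i ∈ Finset.range (L + 1), (1 - q) := by simp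
    rw [e, ← Finset.prod_mul_distrib]
    refine Finset.prod_congr rfl fun i _ => ?_
    rw [← qNat_mul]
    field_simp
  have h2 : (1 - q) * ∑ a ∈ Finset.range (k + 1), (q ^ a) ^ (L + 1) *
        (1 - (q ^ (L + 1) - E) * q ^ a) ^ L =
      ∑ r ∈ Finset.range (L + 1), (L.choose r : ℝ) * ((E - q ^ (L + 1)) ^ r *
            ((1 - (q ^ (k + 1)) ^ (L + 1 + r)) / qNat q (L + 1 + r))) := by
    have hx : ∀ a : ℕ, (q ^ a) ^ (L + 1) * (1 - (q ^ (L + 1) - E) * q ^ a) ^ L =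
        ∑ r ∈ Finset.range (L + 1), ((L.choose r : ℝ) * (E - q ^ (L + 1)) ^ r) *
          (q ^ (L + 1 + r)) ^ a := by
      intro a
      rw [show 1 - (q ^ (L + 1) - E) * q ^ a = (E - q ^ (L + 1)) * q ^ a + 1 by ring, add_pow,
        Finset.mul_sum]
      refine Finset.sum_congr rfl fun r _ => ?_
      rw [mul_pow, ← pow_mul q (L + 1 + r), mul_comm (L + 1 + r) a, pow_mul]
      ring
    simp_rw [hx]
    rw [Finset.sum_comm, Finset.mul_sum]
    refine Finset.sum_congr rfl fun r _ => ?_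
    rw [← Finset.mul_sum]
    -- One of the `L + 1` factors `1 - q` is spent on the geometric sum; the others give the order
    -- `n ^ (-L)`. The exact evaluation makes a Riemann sum argument unnecessary.
    have hg : (1 - q) * ∑ a ∈ Finset.range (k + 1), (q ^ (L + 1 + r)) ^ a =
        (1 - (q ^ (k + 1)) ^ (L + 1 + r)) / qNat q (L + 1 + r) := by
      have hj := qNat_pos hq (show 0 < L + 1 + r by omega)
      rw [eq_div_iff hj.ne', mul_right_comm, qNat_mul, mul_comm, geom_sum_mul_neg, ← pow_mul,
        ← pow_mul, mul_comm (k + 1)]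
    rw [← hg]
    ring
  rw [h1, ← h2, pow_succ]
  ring

/-! ### The two asymptotic regimes -/

theorem tendsto_div_of_isEquivalent {d : ℝ} (hd : 0 < d) {k : ℕ → ℕ}
    (hk : (fun n => (k n : ℝ)) ~[atTop] (fun n => d * (n : ℝ))) :
    Tendsto (fun n : ℕ => (k n : ℝ) / n) atTop (𝓝 d) := by
  have h0 : ∀ᶠ n : ℕ in atTop, d * (n : ℝ) ≠ 0 := by
    filter_upwards [eventually_gt_atTop 0] with n hn
    positivity
  have h := ((isEquivalent_iff_tendsto_one h0).mp hk).const_mul d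
  rw [mul_one] at h
  refine h.congr' ?_
  filter_upwards [eventually_gt_atTop 0] with n hn
  have : (n : ℝ) ≠ 0 := by positivity
  simp only [Pi.div_apply]
  field_simp

theorem asympLE_cluster_of_linear {L : ℕ} {c d : ℝ} (hc : 0 < c) (hd : 0 < d) (hd1 : d < 1)
    {k : ℕ → ℕ} (hk : (fun n => (k n : ℝ)) ~[atTop] (fun n => d * (n : ℝ))) :
    AsympLE
      (fun n => mallowsProb n (1 - c / (n : ℝ)) (clusterEvent n (L + 1) (k n)))
      (fun n => 1 / (1 - Real.exp (-(c * d))) ^ (L + 1) *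
        (∫ y in (Real.exp (-(c * d)))..1,
          y ^ L * Real.exp (clusterGamma c d * Real.exp (c * d) * L * y)) *
        (c ^ L * ((L + 1).factorial : ℝ) / (n : ℝ) ^ L)) := by
  have hk := tendsto_div_of_isEquivalent hd hk
  set I := ∫ y in (Real.exp (-(c * d)))..1,
    y ^ L * Real.exp (clusterGamma c d * Real.exp (c * d) * L * y) with hI
  set u := Real.exp (-(c * d)) with hu
  set E := Real.exp (-(c * (1 - d))) * (1 - u) / (1 - Real.exp (-c)) with hE
  have hcd : 0 < c * d := by positivity
  have hu0 : 0 < u := Real.exp_pos _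
  have hu1 : u < 1 := Real.exp_lt_one_iff.mpr (by linarith)
  have hv1 : Real.exp (-c) < 1 := Real.exp_lt_one_iff.mpr (by linarith)
  have hI0 : 0 < I := by
    refine intervalIntegral.intervalIntegral_pos_of_pos_on
      ((by fun_prop : Continuous _).intervalIntegrable _ _) (fun y hy => ?_) hu1
    have : 0 < y := hu0.trans hy.1
    positivity
  set q : ℕ → ℝ := fun n => 1 - c / (n : ℝ) with hq
  have hinv : Tendsto (fun n : ℕ => c / (n : ℝ)) atTop (𝓝 0) := 
    tendsto_const_div_atTop_nhds_zero_nat c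
  have hq1 : Tendsto q atTop (𝓝 1) := by simpa [hq] using hinv.const_sub 1
  have hqpos : ∀ᶠ n in atTop, 0 < q n := hq1.eventually_const_lt one_pos
  have hlog : Tendsto (fun n : ℕ => (n : ℝ) * Real.log (q n)) atTop (𝓝 (-c)) := by
    have h := Real.tendsto_nat_mul_log_one_add_of_tendsto (g := fun n => -(c / (n : ℝ))) (t := -c)
      (tendsto_const_nhds.congr' (by
        filter_upwards [eventually_gt_atTop 0] with n hn
        have : (n : ℝ) ≠ 0 := by positivity
        field_simp))
    simpa only [← sub_eq_add_neg] using h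
  -- The finite bounds count entries from `0`; truncation is harmless because `k n ≥ 1` eventually.
  set k' : ℕ → ℕ := fun n => k n - 1 with hk'
  have hkpos : ∀ᶠ n in atTop, 1 ≤ k n := by
    filter_upwards [hk.eventually_const_lt hd] with n hn
    by_contra h
    have : k n = 0 := by omega
    simp [this] at hn
  have hshift : ∀ j : ℕ, Tendsto (fun n : ℕ => ((k' n + j + 1 : ℕ) : ℝ) / n) atTop (𝓝 d) := by
    intro j
    have h := hk.add (tendsto_const_div_atTop_nhds_zero_nat (j : ℝ))
    rw [add_zero] at h
    refine h.congr' ?_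
    filter_upwards [hkpos] with n hn
    rw [← add_div, ← Nat.cast_add, show k n + j = k' n + j + 1 by simp only [hk']; omega]
  have hKn : ∀ᶠ n in atTop, k' n + (L + 1) ≤ n := by
    filter_upwards [(hshift L).eventually_lt_const hd1, eventually_gt_atTop 0] with n hn hn0
    have : (0 : ℝ) < n := by positivity
    rw [div_lt_one this] at hn
    have : k' n + L + 1 < n := by exact_mod_cast hn
    omega
  have hone : Tendsto (fun n : ℕ => (n : ℝ) / n) atTop (𝓝 1) :=
    tendsto_const_nhds.congr' (by
      filter_upwards [eventually_gt_atTop 0] with n hn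
      rw [div_self (by positivity)])
  have hpow : ∀ j : ℕ, Tendsto (fun n => q n ^ (k' n + j + 1)) atTop (𝓝 u) := fun j => by
    have := tendsto_pow_of_tendsto_mul_log hqpos hlog (hshift j)
    rwa [neg_mul] at this
  have hpown : Tendsto (fun n => q n ^ n) atTop (𝓝 (Real.exp (-c))) := by
    have := tendsto_pow_of_tendsto_mul_log hqpos hlog hone
    rwa [mul_one] at this
  have hpowd : Tendsto (fun n => q n ^ (n - (k' n + (L + 1)))) atTop
      (𝓝 (Real.exp (-(c * (1 - d))))) := by
    rw [← neg_mul]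
    refine tendsto_pow_of_tendsto_mul_log hqpos hlog ((hone.sub (hshift L)).congr' ?_)
    filter_upwards [hKn] with n hn
    rw [Nat.cast_sub hn, sub_div]
    rfl
  have hbase : Tendsto (fun n => decayBase (q n) (k' n + (L + 1)) n) atTop (𝓝 E) :=
    (hpowd.mul ((hpow L).const_sub 1)).div (hpown.const_sub 1) (by linarith)
  set U : ℕ → ℝ := fun n =>
    (∏ i ∈ Finset.range (L + 1), qNat (q n) (i + 1) / (1 - (q n) ^ (k' n + i + 1))) *
        ∑ r ∈ Finset.range (L + 1), (L.choose r : ℝ) *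
          ((decayBase (q n) (k' n + (L + 1)) n - (q n) ^ (L + 1)) ^ r *
            ((1 - ((q n) ^ (k' n + 1)) ^ (L + 1 + r)) / qNat (q n) (L + 1 + r))) with hUdef
  have hU : Tendsto U atTop (𝓝 ((∏ i ∈ Finset.range (L + 1), ((i + 1 : ℕ) : ℝ) / (1 - u)) *
      ∑ r ∈ Finset.range (L + 1), (L.choose r : ℝ) *
        ((E - 1 ^ (L + 1)) ^ r * ((1 - u ^ (L + 1 + r)) / (L + 1 + r : ℕ))))) := by
    refine Tendsto.mul (tendsto_finsetProd _ fun i _ => ?_)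
      (tendsto_finsetSum _ fun r _ => Tendsto.const_mul _ (Tendsto.mul ?_ ?_))
    · exact (tendsto_qNat hq1 _).div ((hpow i).const_sub 1) (by linarith)
    · exact (hbase.sub (hq1.pow _)).pow r
    · exact (((hpow 0).pow _).const_sub 1).div (tendsto_qNat hq1 _) (by positivity)
  have hprod : (∏ i ∈ Finset.range (L + 1), ((i + 1 : ℕ) : ℝ) / (1 - u)) =
      (L + 1).factorial * (1 / (1 - u) ^ (L + 1)) := by
    rw [Finset.prod_div_distrib, ← Nat.cast_prod, Finset.prod_range_add_one_eq_factorial]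
    simp [div_eq_mul_inv]
  have hsum : ∑ r ∈ Finset.range (L + 1), (L.choose r : ℝ) *
        ((E - 1 ^ (L + 1)) ^ r * ((1 - u ^ (L + 1 + r)) / (L + 1 + r : ℕ))) =
      ∫ y in u..1, y ^ L * (1 - (1 - E) * y) ^ L := by
    rw [integral_pow_mul_pow, one_pow, neg_sub]
  rw [hprod, hsum] at hU
  have hM : 0 < ((L + 1).factorial : ℝ) * (1 / (1 - u) ^ (L + 1)) := by
    have : 0 < 1 - u := by linarith
    positivity
  refine asympLE_of_tendsto (U := fun n => U n /
    (((L + 1).factorial : ℝ) * (1 / (1 - u) ^ (L + 1)) * I)) ?_ (hU.div_const _) ?_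
  · filter_upwards [hqpos, hKn, hkpos, eventually_gt_atTop 0] with n h1 h2 h3 h4
    have hn0 : (0 : ℝ) < n := by positivity
    have hlt : q n < 1 := by
      have : 0 < c / (n : ℝ) := by positivity
      simp only [hq]; linarith
    have hb := mallowsProb_clusterEvent_le_expanded h1 hlt h2
    have hkk : k' n + 1 = k n := by simp only [hk']; omega
    rw [hkk, show (1 - q n) = c / n by simp [hq], ← hkk] at hb
    rw [← hkk]
    have hb' : mallowsProb n (q n) (clusterEvent n (L + 1) (k' n + 1)) ≤ (c / n) ^ L * U n := hb
    have hu1' : 0 < 1 - u := by linarith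
    calc _ ≤ (c / n) ^ L * U n / (1 / (1 - u) ^ (L + 1) * I *
          (c ^ L * ((L + 1).factorial : ℝ) / (n : ℝ) ^ L)) :=
          div_le_div_of_nonneg_right hb' (by positivity)
      _ = _ := by
          rw [div_pow]
          field_simp
  · rw [mul_div_mul_left _ _ hM.ne', div_le_one hI0]
    exact integral_le_integral_exp hc hd L

theorem asympLE_cluster_of_isLittleO {L : ℕ} {q : ℕ → ℝ} (hq1 : ∀ᶠ n in atTop, q n < 1)
    (hq : (fun n => 1 - q n) =o[atTop] (fun n : ℕ => 1 / (n : ℝ))) {k : ℕ → ℕ}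
    (hk : ∀ᶠ n in atTop, 1 ≤ k n ∧ k n + (L + 1) ≤ n + 1) :
    AsympLE (fun n => mallowsProb n (q n) (clusterEvent n (L + 1) (k n)))
      (fun n => ((L + 1).factorial : ℝ) / (n : ℝ) ^ L) := by
  have hε : Tendsto (fun n : ℕ => (n : ℝ) * (1 - q n)) atTop (𝓝 0) := by
    refine hq.tendsto_div_nhds_zero.congr fun n => ?_
    rw [div_div_eq_mul_div, div_one, mul_comm]
  have hqpos : ∀ᶠ n in atTop, 0 < q n := by
    filter_upwards [hε.eventually_lt_const one_pos, hq1, eventually_gt_atTop 0] with n h1 h2 h3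
    have : (1 : ℝ) ≤ n := by exact_mod_cast h3
    nlinarith
  have hlog : Tendsto (fun n : ℕ => (n : ℝ) * Real.log (q n)) atTop (𝓝 0) := by
    have h := Real.tendsto_nat_mul_log_one_add_of_tendsto (g := fun n => -(1 - q n)) (t := 0)
      (by simpa [mul_sub] using hε.neg)
    simpa using h
  have hone : Tendsto (fun n : ℕ => (n : ℝ) / n) atTop (𝓝 1) :=
    tendsto_const_nhds.congr' (by
      filter_upwards [eventually_gt_atTop 0] with n hn
      rw [div_self (by positivity)])
  have hQ : Tendsto (fun n => q n ^ n) atTop (𝓝 1) := by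
    have := tendsto_pow_of_tendsto_mul_log hqpos hlog hone
    rwa [zero_mul, Real.exp_zero] at this
  set F : ℝ := ((L + 1).factorial : ℝ) with hF
  have hF0 : 0 < F := by positivity
  have hratio : Tendsto (fun n : ℕ => (n : ℝ) / ((n : ℝ) - L)) atTop (𝓝 1) := by
    have h := ((tendsto_const_div_atTop_nhds_zero_nat (L : ℝ)).const_sub 1).inv₀ (by simp)
    rw [sub_zero, inv_one] at h
    refine h.congr' ?_
    filter_upwards [eventually_gt_atTop 0] with n hn
    have : (n : ℝ) ≠ 0 := by positivity
    rw [one_sub_div this, inv_div]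
  -- The limit `1`, written termwise: `0` for each `r < L`, and `1` for `r = L`.
  refine asympLE_of_tendsto (v := ∑ r ∈ Finset.range L, 0 + 1) (U := fun n =>
    ∑ r ∈ Finset.range L, (L.choose r : ℝ) *
      ((L + 1) ^ L * (n * (1 - q n)) ^ (L - r) / (q n ^ n) ^ (L + 1 + r)) +
      1 / (q n ^ n) ^ (L + 1) * (n / ((n : ℝ) - L)) ^ L) ?_ ?_ (by simp)
  · filter_upwards [hqpos, hq1, hk] with n h1 h2 ⟨h3, h4⟩
    obtain ⟨k', hk'⟩ : ∃ k', k n = k' + 1 := ⟨k n - 1, by omega⟩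
    have hn : k' + (L + 1) ≤ n := by omega
    have hn0 : (0 : ℝ) < n := by exact_mod_cast (show 0 < n by omega)
    have hnL : (0 : ℝ) < (n : ℝ) - L := by
      have : (L : ℝ) < n := by exact_mod_cast (show L < n by omega)
      linarith
    rw [hk', div_le_iff₀ (by positivity), add_mul, Finset.sum_mul]
    refine (mallowsProb_clusterEvent_le_sum h1 h2 hn).trans ?_
    rw [Finset.sum_range_succ]
    refine add_le_add (Finset.sum_le_sum fun r hr => ?_) ?_
    · have hr := Finset.mem_range.mp hr
      refine (mul_le_mul_of_nonneg_left (lower_term_le h1 h2 hn hr.le)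
        (by positivity)).trans_eq ?_
      rw [← hF]
      field_simp
    · rw [Nat.choose_self, Nat.cast_one, one_mul]
      refine (top_term_le h1 h2 hn).trans_eq ?_
      rw [← hF, div_pow]
      field_simp
  · refine Tendsto.add (tendsto_finsetSum _ fun r hr => ?_) ?_
    · have hr := Finset.mem_range.mp hr
      have h := ((hε.pow (L - r)).const_mul ((L + 1 : ℝ) ^ L)).div (hQ.pow (L + 1 + r)) (by simp)
      have h' := h.const_mul (L.choose r : ℝ)
      rwa [zero_pow (by omega), mul_zero, zero_div, mul_zero] at h'
    · have h := ((hQ.pow (L + 1)).inv₀ (by simp)).mul (hratio.pow L)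
      simpa using h

theorem theorem2 (l : ℕ) (hl : 2 ≤ l) :
    (∀ c d : ℝ, 0 < c → 0 < d → d < 1 →
      ∀ k : ℕ → ℕ, (fun n => (k n : ℝ)) ~[atTop] (fun n => d * (n : ℝ)) →
        AsympLE
          (fun n => mallowsProb n (1 - c / (n : ℝ)) (clusterEvent n l (k n)))
          (fun n => 1 / (1 - Real.exp (-(c * d))) ^ l *
            (∫ y in (Real.exp (-(c * d)))..1,
              y ^ (l - 1) *
                Real.exp (clusterGamma c d * Real.exp (c * d) * ((l : ℝ) - 1) * y)) *
            (c ^ (l - 1) * (l.factorial : ℝ) / (n : ℝ) ^ (l - 1)))) ∧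
    (∀ q : ℕ → ℝ, (∀ᶠ n in atTop, q n < 1) →
      (fun n => 1 - q n) =o[atTop] (fun n => 1 / (n : ℝ)) →
      ∀ k : ℕ → ℕ, (∀ᶠ n in atTop, 1 ≤ k n ∧ k n + l ≤ n + 1) →
        AsympLE
          (fun n => mallowsProb n (q n) (clusterEvent n l (k n)))
          (fun n => (l.factorial : ℝ) / (n : ℝ) ^ (l - 1))) := by
  obtain ⟨L, rfl⟩ : ∃ L, l = L + 1 := ⟨l - 1, by omega⟩
  have hL : ((L + 1 : ℕ) : ℝ) - 1 = L := by push_cast; ring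
  rw [Nat.add_sub_cancel, hL]
  exact ⟨fun c d hc hd hd1 k hk => asympLE_cluster_of_linear hc hd hd1 hk,
    fun q hq1 hq k hk => asympLE_cluster_of_isLittleO hq1 hq hk⟩
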